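/- Let $\mathcal I$ be a set of principals containing three (not necessarily distinct) principals $A,B,S$ and the intruder $I\notin\{A,B,S\}$. Every principal $a$ has a key pair $k_a,k_a^{-1}$. Messages are freely generated from atoms (identities, keys, nonces $N_a^i$ for $i\in\mathbb N$, a secret $sec$, and values that the intruder creates herself) by pairing $m.m'$ (bracketed to the right) and encryption $\{m\}_k$, where $k$ is a key. Consider the protocol $p$ 1. $A\to S:\ \{A.N_a.S.B\}_{k_s}$ 2. $S\to B:\ \{B.A.S.N_a\}_{k_b}\,.\,\{A.B.S.\{S.sec\}_{k_a}\}_{k_b}$ 3. $B\to A:\ \{B.\{S.sec\}_{k_a}.A.N_a.S\}_{k_a}$ where $k_a,k_b,k_s$ are the public keys of $A,B,S$. Its generalized roles in session $i$ are: $A$ sends $\{A.N_a^i.S.B\}_{k_s}$ and then receives $\{B.\{S.X\}_{k_a}.A.N_a^i.S\}_{k_a}$; $B$ receives $\{B.A.S.Y\}_{k_b}.\{A.B.S.Z\}_{k_b}$ and then sends $\{B.Z.A.Y.S\}_{k_a}$; $S$ receives $\{A.T.S.B\}_{k_s}$ and then sends $\{B.A.S.T\}_{k_b}.\{A.B.S.\{S.sec\}_{k_a}\}_{k_b}$.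 Here $X,Y,Z,T$ are variables that stand for arbitrary messages. Security levels are sets of principals ordered by reverse inclusion ($\tau\sqsupseteq\tau'$ iff $\tau\subseteq\tau'$). The context assigns to every atom $\alpha$ a level $\ulcorner\alpha\urcorner$: identities and public keys have the bottom level $\mathcal I$; $\ulcorner k_a^{-1}\urcorner=\{a\}$ for every principal $a$; $\ulcorner N_a^i\urcorner=\{A,B,S\}$; $\ulcorner sec\urcorner=\{A,S\}$; values created by the intruder have level $\{I\}$. The initial knowledge $K(I)$ of the intruder consists of all identities, all public keys, her own private key, and the values that she creates. The intruder is a Dolev–Yao intruder: from a set $M$ of messages she infers the elements of $M\cup K(I)$ and whatever follows from them by pairing, projection, encryption with keys that she can infer, and decryption when she can infer the inverse key. A valid trace is a finite interleaving of (possibly incomplete) runs of the generalized roles, with at most one run of each role for each session identifier $i\in\mathbb N$ and one substitution of messages for variables in each run, in which every message received by a role can be inferred by the intruder from the messages exchanged before. Then $p$ is correct for secrecy: for every valid trace $\rho$ and every atom $\alpha$ that the intruder can infer from the messages of $\rho$, there is $\beta\in K(I)$ with $\ulcorner\beta\urcorner\sqsupseteq\ulcorner\alpha\urcorner$. In particular,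 the intruder cannot infer $sec$ from any valid trace of $p$. -/

import Mathlib

namespace SecrecyProtocol

universe u

/-- A public-key pair per principal: `pub a` is the key `k_a`, `priv a` is its inverse `k_a⁻¹`. -/
inductive Key (Agent : Type u) : Type u
  | pub : Agent → Key Agent
  | priv : Agent → Key Agent

/-- The inverse of a key; `(k⁻¹)⁻¹ = k`. -/
def Key.inverse {Agent : Type u} : Key Agent → Key Agent
  | .pub a => .priv a
  | .priv a => .pub a

/-- Atomic messages: identities, keys, the nonce `N_a^i` that the role of `A` creates in session
`i`, the secret `sec`, and a supply of values that the intruder can create herself. -/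
inductive Atom (Agent : Type u) : Type u
  | agent : Agent → Atom Agent
  | key : Key Agent → Atom Agent
  | nonce : ℕ → Atom Agent
  | sec : Atom Agent
  | intruderValue : ℕ → Atom Agent

/-- Closed messages: the free algebra over atoms with pairing and encryption by a key. -/
inductive Msg (Agent : Type u) : Type u
  | atom : Atom Agent → Msg Agent
  | pair : Msg Agent → Msg Agent → Msg Agent
  | enc : Msg Agent → Key Agent → Msg Agent

/-- The variables that stand for unknown messages in generalized roles. -/
inductive Var : Type
  | X | Y | Z | T

/-- Messages with variables, as they occur in generalized roles. -/
inductive Term (Agent : Type u) : Type u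
  | var : Var → Term Agent
  | atom : Atom Agent → Term Agent
  | pair : Term Agent → Term Agent → Term Agent
  | enc : Term Agent → Key Agent → Term Agent

/-- A (closing) substitution: every variable may be replaced by an arbitrary message. -/
abbrev Subst (Agent : Type u) : Type u := Var → Msg Agent

/-- The closed message `tσ`. -/
def Term.subst {Agent : Type u} (σ : Subst Agent) : Term Agent → Msg Agent
  | .var x => σ x
  | .atom α => .atom α
  | .pair t t' => .pair (t.subst σ) (t'.subst σ)
  | .enc t k => .enc (t.subst σ) k

/-- The security lattice `(2^I, ⊆, ∩, ∪, I, ∅)`: the lattice of sets of principals ordered by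
reverse inclusion, so that the bottom element is the set of all principals (public) and the top
element is the empty set. -/
abbrev Level (Agent : Type u) : Type u := (Set Agent)ᵒᵈ

/-- A context of verification: the security level of every atom (the principals that are allowed to
know it), and the initial knowledge of the intruder. -/
structure Context (Agent : Type u) where
  level : Atom Agent → Level Agent
  knowledge : Set (Atom Agent)

/-- The intruder is entitled to `α`: some atom of her initial knowledge has a level that is at least
the level of `α`. -/
def Context.Allowed {Agent : Type u} (C : Context Agent) (α : Atom Agent) : Prop :=
  ∃ β ∈ C.knowledge, C.level α ≤ C.level β

/-- Dolev-Yao deduction of the intruder in the context `C`, from the set `M` of messages together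
with her initial knowledge. -/
inductive Context.Infers {Agent : Type u} (C : Context Agent) (M : Set (Msg Agent)) :
    Msg Agent → Prop
  | initial {α : Atom Agent} : α ∈ C.knowledge → Context.Infers C M (.atom α)
  | observed {m : Msg Agent} : m ∈ M → Context.Infers C M m
  | pair {m m' : Msg Agent} : Context.Infers C M m → Context.Infers C M m' →
      Context.Infers C M (.pair m m')
  | fst {m m' : Msg Agent} : Context.Infers C M (.pair m m') → Context.Infers C M m
  | snd {m m' : Msg Agent} : Context.Infers C M (.pair m m') → Context.Infers C M m'
  | encrypt {m : Msg Agent} {k : Key Agent} : Context.Infers C M m →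
      Context.Infers C M (.atom (.key k)) → Context.Infers C M (.enc m k)
  | decrypt {m : Msg Agent} {k : Key Agent} : Context.Infers C M (.enc m k) →
      Context.Infers C M (.atom (.key k.inverse)) → Context.Infers C M m

/-- A step of a generalized role: the principal receives a message from the network (that is, from
the intruder), or sends one to the network. -/
inductive Step (Agent : Type u) : Type u
  | recv : Term Agent → Step Agent
  | send : Term Agent → Step Agent

/-- The message of a step. -/
def Step.term {Agent : Type u} : Step Agent → Term Agent
  | .recv t => t
  | .send t => t

/-- A protocol in role-based specification: a family of generalized roles, each of them a sequence
of steps that depends on the session identifier. -/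
abbrev Protocol (Role : Type) (Agent : Type u) : Type u := Role → ℕ → List (Step Agent)

/-- An event of a trace: in its run with the given session identifier, a role has executed its next
step, with the given closed message. -/
structure Event (Role : Type) (Agent : Type u) where
  role : Role
  session : ℕ
  msg : Msg Agent

/-- The messages exchanged in a trace. -/
def messages {Role : Type} {Agent : Type u} (ρ : List (Event Role Agent)) : Set (Msg Agent) :=
  {m | ∃ e ∈ ρ, e.msg = m}

/-- The number of steps that the run of role `R` in session `i` has executed in the trace `ρ`. -/
def stepsDone {Role : Type} [DecidableEq Role] {Agent : Type u} (ρ : List (Event Role Agent))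
    (R : Role) (i : ℕ) : ℕ :=
  ρ.countP (fun e => e.role = R ∧ e.session = i)

/-- `IsValid C p σ ρ`: the trace `ρ` (in chronological order) is an interleaving of runs of the
generalized roles of `p`. The run of role `R` in session `i` is instantiated by the substitution
`σ R i`, executes its steps in the order of the role, and need not be complete; every message that
a role receives is one that the intruder can infer from the messages exchanged before. -/
inductive IsValid {Role : Type} [DecidableEq Role] {Agent : Type u} (C : Context Agent)
    (p : Protocol Role Agent) (σ : Role → ℕ → Subst Agent) : List (Event Role Agent) → Prop
  | nil : IsValid C p σ []
  | snoc {ρ : List (Event Role Agent)} {R : Role} {i : ℕ} {s : Step Agent} :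
      IsValid C p σ ρ →
      (p R i)[stepsDone ρ R i]? = some s →
      (∀ t, s = .recv t → C.Infers (messages ρ) (t.subst (σ R i))) →
      IsValid C p σ (ρ ++ [⟨R, i, s.term.subst (σ R i)⟩])

/-- The set of valid traces of `p`. -/
def validTraces {Role : Type} [DecidableEq Role] {Agent : Type u} (C : Context Agent)
    (p : Protocol Role Agent) : Set (List (Event Role Agent)) :=
  {ρ | ∃ σ : Role → ℕ → Subst Agent, IsValid C p σ ρ}

/-- `p` discloses the atom `α` in `C`: from some valid trace the intruder infers `α`, although she
is not entitled to it. -/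
def Discloses {Role : Type} [DecidableEq Role] {Agent : Type u} (C : Context Agent)
    (p : Protocol Role Agent) (α : Atom Agent) : Prop :=
  ∃ ρ ∈ validTraces C p, C.Infers (messages ρ) (.atom α) ∧ ¬ C.Allowed α

/-- `p` is correct for secrecy in `C`: it discloses no atom. -/
def CorrectForSecrecy {Role : Type} [DecidableEq Role] {Agent : Type u} (C : Context Agent)
    (p : Protocol Role Agent) : Prop :=
  ∀ α : Atom Agent, ¬ Discloses C p α

/-- Security levels: identities and public keys are public, the private key of `a` is known to `a`
only, the nonces are shared by `A`, `B` and `S`, the secret is shared by `A` and `S` only, and the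
values created by the intruder `I` are her own. -/
def pLevel {Agent : Type u} (A B S I : Agent) : Atom Agent → Level Agent
  | .agent _ => ⊥
  | .key (.pub _) => ⊥
  | .key (.priv a) => OrderDual.toDual {a}
  | .nonce _ => OrderDual.toDual {A, B, S}
  | .sec => OrderDual.toDual {A, S}
  | .intruderValue _ => OrderDual.toDual {I}

/-- The context of verification. The intruder `I` initially knows all identities, all public keys,
her own private key, and the values that she can create. -/
def pContext {Agent : Type u} (A B S I : Agent) : Context Agent where
  level := pLevel A B S I
  knowledge :=
    {α | (∃ a, α = .agent a) ∨ (∃ a, α = .key (.pub a)) ∨ α = .key (.priv I) ∨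
      ∃ n, α = .intruderValue n}

/-- The three roles of the protocol. -/
inductive PRole : Type
  | roleA | roleB | roleS
  deriving DecidableEq

/-- Concatenation `t . t'`, right associative. -/
local infixr:65 " ⬝ " => Term.pair

/-- The generalized roles of the protocol

    1. A → S : {A.N_a.S.B}_{k_s}
    2. S → B : {B.A.S.N_a}_{k_b} . {A.B.S.{S.sec}_{k_a}}_{k_b}
    3. B → A : {B.{S.sec}_{k_a}.A.N_a.S}_{k_a}

in session `i`. -/
def protocolP {Agent : Type u} (A B S : Agent) : Protocol PRole Agent :=
  let a : Term Agent := .atom (.agent A)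
  let b : Term Agent := .atom (.agent B)
  let s : Term Agent := .atom (.agent S)
  let sec : Term Agent := .atom .sec
  let x : Term Agent := .var .X
  let y : Term Agent := .var .Y
  let z : Term Agent := .var .Z
  let t : Term Agent := .var .T
  fun R i =>
    let na : Term Agent := .atom (.nonce i)
    match R with
    | .roleA =>
      [ .send (.enc (a ⬝ na ⬝ s ⬝ b) (.pub S)),
        .recv (.enc (b ⬝ (.enc (s ⬝ x) (.pub A)) ⬝ a ⬝ na ⬝ s) (.pub A)) ]
    | .roleB =>
      [ .recv ((.enc (b ⬝ a ⬝ s ⬝ y) (.pub B)) ⬝ (.enc (a ⬝ b ⬝ s ⬝ z) (.pub B))),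
        .send (.enc (b ⬝ z ⬝ a ⬝ y ⬝ s) (.pub A)) ]
    | .roleS =>
      [ .recv (.enc (a ⬝ t ⬝ s ⬝ b) (.pub S)),
        .send ((.enc (b ⬝ a ⬝ s ⬝ t) (.pub B)) ⬝
          (.enc (a ⬝ b ⬝ s ⬝ (.enc (s ⬝ sec) (.pub A))) (.pub B))) ]

end SecrecyProtocol

namespace SecrecyProtocol

universe v

/-! Secrecy rests on an invariant: every atom that occurs outside all encryptions under the public
keys of `A`, `B`, `S` is one to which the intruder is entitled. Deduction cannot break it
(`Context.Infers.isProtected`), since opening such an encryption needs a private key of `A`, `B` or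
`S`, itself an atom that the invariant denies her. The roles cannot break it either
(`protocolP_send_protected`): all they send lies under these keys, so forged or ill-typed values of
the variables are harmless. -/

/-- `m` reveals only atoms to which the intruder is entitled in `C`, provided that she cannot
decrypt messages that are encrypted with a key in `H`. -/
def Context.Protected {Agent : Type v} (C : Context Agent) (H : Set (Key Agent)) :
    Msg Agent → Prop
  | .atom α => C.Allowed α
  | .pair m m' => C.Protected H m ∧ C.Protected H m'
  | .enc m k => k ∈ H ∨ C.Protected H m

/-- Deduction preserves protection, if the intruder is not entitled to the inverses of the keys
in `H`. -/
theorem Context.Infers.isProtected {Agent : Type v} {C : Context Agent} {H : Set (Key Agent)}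
    (hH : ∀ k ∈ H, ¬ C.Allowed (.key k.inverse)) {M : Set (Msg Agent)}
    (hM : ∀ m ∈ M, C.Protected H m) {m : Msg Agent} (h : C.Infers M m) : C.Protected H m := by
  induction h with
  | initial hα => exact ⟨_, hα, le_rfl⟩
  | observed hm => exact hM _ hm
  | pair _ _ ih ih' => exact ⟨ih, ih'⟩
  | fst _ ih => exact ih.1
  | snd _ ih => exact ih.2
  -- Whichever key the intruder uses, the plaintext was already protected.
  | encrypt _ _ ih _ => exact Or.inr ih
  -- For an atom, protection is entitlement: `ihk` says that the intruder is entitled to the inverse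
  -- key, which `hH` excludes for keys in `H`.
  | decrypt _ _ ih ihk => exact ih.resolve_left fun hk => hH _ hk ihk

/-- If all messages that the roles send are protected, whatever is substituted for the variables,
then all messages of a valid trace are. -/
theorem IsValid.isProtected {Role : Type} [DecidableEq Role] {Agent : Type v} {C : Context Agent}
    {p : Protocol Role Agent} {H : Set (Key Agent)}
    (hH : ∀ k ∈ H, ¬ C.Allowed (.key k.inverse))
    (hp : ∀ R i t, Step.send t ∈ p R i → ∀ τ : Subst Agent, C.Protected H (t.subst τ))
    {σ : Role → ℕ → Subst Agent} {ρ : List (Event Role Agent)} (h : IsValid C p σ ρ) :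
    ∀ m ∈ messages ρ, C.Protected H m := by
  induction h with
  | nil => rintro m ⟨e, he, -⟩; cases he
  | @snoc ρ R i s _ hs hrecv ih =>
    rintro m ⟨e, he, rfl⟩
    rcases List.mem_append.1 he with he | he
    · exact ih _ ⟨e, he, rfl⟩
    · obtain rfl := List.mem_singleton.1 he
      cases s with
      -- A received message was inferred from earlier ones, so it inherits their protection.
      | recv t => exact (hrecv t rfl).isProtected hH ih
      | send t => exact hp R i t (List.mem_of_getElem? hs) _

/-- A protocol that sends only protected messages is correct for secrecy. -/
theorem correctForSecrecy_of_protected {Role : Type} [DecidableEq Role] {Agent : Type v}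
    {C : Context Agent} {p : Protocol Role Agent} {H : Set (Key Agent)}
    (hH : ∀ k ∈ H, ¬ C.Allowed (.key k.inverse))
    (hp : ∀ R i t, Step.send t ∈ p R i → ∀ τ : Subst Agent, C.Protected H (t.subst τ)) :
    CorrectForSecrecy C p := by
  rintro α ⟨ρ, ⟨σ, hρ⟩, hα, hn⟩
  exact hn (hα.isProtected hH (hρ.isProtected hH hp))

/-- The intruder is entitled only to atoms that she is among the principals allowed to know. -/
theorem mem_pLevel_of_allowed {Agent : Type v} {A B S I : Agent} {α : Atom Agent}
    (h : (pContext A B S I).Allowed α) : I ∈ OrderDual.ofDual (pLevel A B S I α) := by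
  obtain ⟨β, hβ, hle⟩ := h
  -- The order on levels is reverse inclusion, so it suffices that `I` belongs to the level of each
  -- atom she knows initially.
  apply show OrderDual.ofDual (pLevel A B S I β) ⊆ OrderDual.ofDual (pLevel A B S I α) from hle
  rcases hβ with ⟨a, rfl⟩ | ⟨a, rfl⟩ | rfl | ⟨n, rfl⟩
  · exact Set.mem_univ I
  · exact Set.mem_univ I
  · exact Set.mem_singleton I
  · exact Set.mem_singleton I

/-- The protocol sends only messages encrypted with the public keys of `A`, `B` and `S`. -/
theorem protocolP_send_protected {Agent : Type v} (C : Context Agent) (A B S : Agent)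
    (R : PRole) (i : ℕ) (t : Term Agent) (ht : Step.send t ∈ protocolP A B S R i)
    (τ : Subst Agent) : C.Protected {.pub A, .pub B, .pub S} (t.subst τ) := by
  -- Each sent term is an encryption under a key of `H` or a pair of two, so the values of the
  -- variables are never inspected.
  cases R <;> simp [protocolP] at ht <;> subst ht <;> simp [Term.subst, Context.Protected]

end SecrecyProtocol

theorem mainTheorem1 {Agent : Type*} (A B S I : Agent) (hA : A ≠ I) (hB : B ≠ I) (hS : S ≠ I) :
    SecrecyProtocol.CorrectForSecrecy (SecrecyProtocol.pContext A B S I)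
      (SecrecyProtocol.protocolP A B S) ∧
    ∀ ρ ∈ SecrecyProtocol.validTraces (SecrecyProtocol.pContext A B S I)
      (SecrecyProtocol.protocolP A B S),
      ¬ (SecrecyProtocol.pContext A B S I).Infers (SecrecyProtocol.messages ρ)
        (.atom .sec) := by
  have hcorrect : SecrecyProtocol.CorrectForSecrecy (SecrecyProtocol.pContext A B S I)
      (SecrecyProtocol.protocolP A B S) := by
    refine SecrecyProtocol.correctForSecrecy_of_protected (H := {.pub A, .pub B, .pub S}) ?_
      (SecrecyProtocol.protocolP_send_protected _ A B S)
    -- The inverse of a public key is a private key, whose level contains only its owner;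
    -- entitlement would make the owner equal to `I`.
    rintro k (rfl | rfl | rfl) h
    · exact hA (SecrecyProtocol.mem_pLevel_of_allowed h).symm
    · exact hB (SecrecyProtocol.mem_pLevel_of_allowed h).symm
    · exact hS (SecrecyProtocol.mem_pLevel_of_allowed h).symm
  refine ⟨hcorrect, fun ρ hρ hsec => hcorrect .sec ⟨ρ, hρ, hsec, fun h => ?_⟩⟩
  -- The level of `sec` is `{A, S}`, so entitlement would force `I = A` or `I = S`.
  rcases SecrecyProtocol.mem_pLevel_of_allowed h with h | h
  · exact hA h.symm
  · exact hS h.symm
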